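/- Let $n\ge 1$ be an integer, let $\hat c$ be real, and put $$w_1(x)=e^{-n(x^2+\hat c x)},\qquad w_2(x)=e^{-nx^2},\qquad w_3(x)=e^{-n(x^2-\hat c x)},\qquad x\in\mathbb{R}.$$ A *multiple Hermite polynomial* $P_{n,n,n}$ for these weights is a monic polynomial of degree $3n$ such that $$\int_{-\infty}^{\infty} x^i P_{n,n,n}(x)\,w_j(x)\,dx=0,\qquad 0\le i\le n-1,\quad j=1,2,3.$$ **Theorem.** There is a constant $c_0$, independent of $n$, such that for every $\hat c>c_0$ and every integer $n\ge1$ the following holds. The polynomial $P_{n,n,n}$ exists and is unique, and it has $3n$ distinct real zeros $x_{1,3n}<x_{2,3n}<\dots<x_{3n,3n}$. Let $$\lambda^{(3)}_{k,3n}=\int_{-\infty}^{\infty}\ \prod_{\substack{1\le i\le 3n\\ i\ne k}}\frac{x-x_{i,3n}}{x_{k,3n}-x_{i,3n}}\; w_3(x)\,dx,\qquad 1\le k\le 3n,$$ be the weights of the interpolatory quadrature rule for $w_3$ with these nodes. This rule satisfies $$\int_{-\infty}^{\infty} f(x)\,e^{-n(x^2-\hat c x)}\,dx=\sum_{k=1}^{3n}\lambda^{(3)}_{k,3n}f(x_{k,3n})$$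 for all real polynomials $f$ of degree at most $4n-1$, and its weights satisfy $$\lambda^{(3)}_{k,3n}>0,\qquad 2n+1\le k\le 3n,$$ $$\operatorname{sign}\lambda^{(3)}_{k,3n}=(-1)^k,\qquad 1\le k\le 2n.$$ -/

import Mathlib

open Polynomial

/-- `P` is a type II multiple orthogonal polynomial with multi-index `m = (m₁, …, m_r)` for the
weight functions `w₁, …, w_r` on the real line: `P` is monic of degree `m₁ + ⋯ + m_r` and
`∫ xⁱ P(x) w_j(x) dx = 0` for `0 ≤ i ≤ m_j - 1` and every `j`. -/
def IsTypeIIMultipleOrthogonal {r : ℕ} (w : Fin r → ℝ → ℝ) (m : Fin r → ℕ) (P : ℝ[X]) : Prop :=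
  P.Monic ∧ P.natDegree = ∑ j, m j ∧
    ∀ j, ∀ i < m j, ∫ x : ℝ, x ^ i * P.eval x * w j x = 0

/-- The three rescaled multiple Hermite weights
`e^{-n(x² + c x)}`, `e^{-n x²}`, `e^{-n(x² - c x)}` (indices `0, 1, 2`). -/
noncomputable def hermiteWeight (n : ℕ) (c : ℝ) : Fin 3 → ℝ → ℝ :=
  ![fun x => Real.exp (-(n : ℝ) * (x ^ 2 + c * x)),
    fun x => Real.exp (-(n : ℝ) * x ^ 2),
    fun x => Real.exp (-(n : ℝ) * (x ^ 2 - c * x))]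

/-- `x 1 < x 2 < ⋯ < x N` are zeros of `P`. When `P` has degree `N`, these are all its complex
zeros, and they are simple. Values of `x` outside `{1, …, N}` play no role. -/
def AreIncreasingZeros (N : ℕ) (P : ℝ[X]) (x : ℕ → ℝ) : Prop :=
  StrictMonoOn x (Set.Icc 1 N) ∧ ∀ k ∈ Set.Icc 1 N, P.IsRoot (x k)

/-- The `k`-th weight of the interpolatory quadrature rule for the integral `∫ f(t) w(t) dt` with
nodes `x 1, …, x N`: the integral against `w` of the `k`-th Lagrange basis polynomial
`∏_{i ≠ k} (t - x i) / (x k - x i)`. -/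
noncomputable def quadratureWeight (w : ℝ → ℝ) (N : ℕ) (x : ℕ → ℝ) (k : ℕ) : ℝ :=
  ∫ t : ℝ, (Lagrange.basis (Finset.Icc 1 N) x k).eval t * w t

/-! Each weight is a constant times a Gaussian `exp (-n (x - a)²)` with `a` one of `-c/2, 0, c/2`.
Polynomials of degree at most `4n` grow too slowly for the tails to matter: if such an `R ≠ 0` is
nonnegative within 300 of `a`, its Gaussian integral is positive, whatever its sign elsewhere
(`integral_eval_mul_exp_pos`). The radius does not depend on `n`, hence neither does `c₀`. The three
weights thus behave as if supported on disjoint intervals once `c > 1200`, and the classical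
argument for such systems applies: orthogonality forces `n` zeros into each interval, which gives
simplicity of the zeros and, by linear algebra, existence and uniqueness of `P`. For the weights,
exactness in degree `4n - 1` is tested on `f = ∏_A (t - x i) · ∏_B (t - x i)²`, where `A` uses only
nodes left of the third interval and `A ∪ B` is every node but `x k`. The integral is positive and
the rule has one surviving term, so its sign is read off from `A`. -/

/-! ### Growth of polynomials outside `[-1, 1]`. -/

theorem Polynomial.exists_derivative_eq_eval_zero (R : ℝ[X]) {N : ℕ} (hR : R.natDegree ≤ N) :
    ∃ S : ℝ[X], derivative S = R ∧ S.eval 0 = 0 ∧ S.natDegree ≤ N + 1 := by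
  refine ⟨∑ k ∈ Finset.range (N + 1), C (R.coeff k / (k + 1)) * X ^ (k + 1), ?_, ?_, ?_⟩
  · conv_rhs => rw [R.as_sum_range_C_mul_X_pow' (Nat.lt_succ_of_le hR)]
    rw [derivative_sum]
    refine Finset.sum_congr rfl fun k _ => ?_
    have h : (k : ℝ) + 1 ≠ 0 := by positivity
    rw [derivative_C_mul_X_pow]
    push_cast
    rw [div_mul_cancel₀ _ h]
  · simp [eval_finsetSum]
  · refine natDegree_sum_le_of_forall_le _ _ fun k hk => ?_
    exact (natDegree_C_mul_X_pow_le _ _).trans (Finset.mem_range.mp hk)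

theorem Polynomial.Chebyshev.eval_U_bounds {x : ℝ} (hx : 1 ≤ x) (k : ℕ) :
    0 ≤ (Chebyshev.U ℝ ((k : ℤ) - 1)).eval x ∧
      (Chebyshev.U ℝ ((k : ℤ) - 1)).eval x ≤ (Chebyshev.U ℝ k).eval x ∧
      (Chebyshev.U ℝ k).eval x ≤ (2 * x) ^ k := by
  induction k with
  | zero => simp
  | succ k ih =>
    obtain ⟨h0, h1, h2⟩ := ih
    have e : (Chebyshev.U ℝ ((k : ℤ) + 1)).eval x =
        2 * x * (Chebyshev.U ℝ (k : ℤ)).eval x - (Chebyshev.U ℝ ((k : ℤ) - 1)).eval x := by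
      rw [Chebyshev.U_add_one]; simp
    push_cast
    rw [show (k : ℤ) + 1 - 1 = k by ring, e, pow_succ]
    refine ⟨by linarith, by nlinarith, by nlinarith⟩

/-- Among polynomials bounded by 1 on `[-1, 1]`, `T_{N+1}` has the largest derivative at `x ≥ 1`,
and `T_{N+1}' = (N+1) U_N`. -/
theorem Polynomial.eval_derivative_le_of_abs_le {S : ℝ[X]} {N : ℕ} (hS : S.natDegree ≤ N + 1)
    {M : ℝ} (hM : 0 < M) (hSM : ∀ y ∈ Set.Icc (-1 : ℝ) 1, |S.eval y| ≤ M) {x : ℝ} (hx : 1 ≤ x) :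
    (derivative S).eval x ≤ (N + 1) * (2 * x) ^ N * M := by
  have h := Chebyshev.eval_iterate_derivative_le_of_forall_abs_le_one (n := N + 1)
    (P := C M⁻¹ * S) (k := 1) hx ?_ ?_
  · simp only [Function.iterate_one, derivative_C_mul, eval_mul, eval_C] at h
    rw [inv_mul_le_iff₀ hM] at h
    refine h.trans ?_
    rw [Chebyshev.T_derivative_eq_U]
    push_cast
    rw [add_sub_cancel_right, eval_mul, mul_comm M]
    have := (Chebyshev.eval_U_bounds hx N).2.2
    simp only [eval_add, eval_one, eval_natCast]
    gcongr
  · refine (natDegree_le_iff_degree_le).mp ((natDegree_C_mul_le _ _).trans hS)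
  · intro y hy
    rw [eval_mul, eval_C, abs_mul, abs_of_pos (inv_pos.mpr hM), inv_mul_le_iff₀ hM]
    simpa using hSM y hy

/-- The antiderivative of `R` vanishing at 0 is bounded on `[-1, 1]` by the `L¹` norm of `R`; the
Chebyshev bound then applies to its derivative. -/
theorem Polynomial.abs_eval_le_of_one_le_abs (R : ℝ[X]) {N : ℕ} (hR : R.natDegree ≤ N) {x : ℝ}
    (hx : 1 ≤ |x|) :
    |R.eval x| ≤ (N + 1) * (2 * |x|) ^ N * ∫ t in (-1 : ℝ)..1, |R.eval t| := by
  obtain ⟨S, hSR, hS0, hSd⟩ := R.exists_derivative_eq_eval_zero hR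
  set J := ∫ t in (-1 : ℝ)..1, |R.eval t| with hJ
  have hint : ∀ a b : ℝ, IntervalIntegrable (fun t => |R.eval t|) MeasureTheory.volume a b :=
    fun a b => (by fun_prop : Continuous fun t => |R.eval t|).intervalIntegrable a b
  have hSJ : ∀ y ∈ Set.Icc (-1 : ℝ) 1, |S.eval y| ≤ J := by
    intro y hy
    have h1 : ∫ t in (0 : ℝ)..y, R.eval t = S.eval y := by
      rw [intervalIntegral.integral_eq_sub_of_hasDerivAt (f := fun t => S.eval t)
        (fun t _ => hSR ▸ S.hasDerivAt t)
        ((by fun_prop : Continuous fun t => R.eval t).intervalIntegrable _ _), hS0, sub_zero]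
    rw [← h1]
    have h2 := intervalIntegral.norm_integral_le_integral_norm_uIoc
      (f := fun t => R.eval t) (a := 0) (b := y) (μ := MeasureTheory.volume)
    rw [Real.norm_eq_abs] at h2
    refine h2.trans ?_
    rw [hJ, intervalIntegral.integral_of_le (by norm_num)]
    refine MeasureTheory.setIntegral_mono_set (hint (-1) 1).1
      (Filter.Eventually.of_forall fun t => abs_nonneg _) (LE.le.eventuallyLE ?_)
    intro t ht
    rw [Set.mem_uIoc] at ht
    rcases ht with ht | ht
    · exact ⟨by linarith [ht.1], ht.2.trans hy.2⟩
    · exact ⟨lt_of_le_of_lt hy.1 ht.1, by linarith [ht.2]⟩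
  have hJ0 : 0 ≤ J := (abs_nonneg _).trans (hSJ 0 (by norm_num))
  have hK : (0 : ℝ) < (N + 1) * (2 * |x|) ^ N := by positivity
  rw [← div_le_iff₀' hK]
  -- The norm `J` may be 0, so the rescaling by `M⁻¹` uses `M > J`.
  refine le_of_forall_gt_imp_ge_of_dense fun M hM => ?_
  have hM0 : 0 < M := hJ0.trans_lt hM
  have hSM : ∀ y ∈ Set.Icc (-1 : ℝ) 1, |S.eval y| ≤ M := fun y hy => (hSJ y hy).trans hM.le
  rw [div_le_iff₀' hK]
  have key : ∀ S : ℝ[X], S.natDegree ≤ N + 1 → (∀ y ∈ Set.Icc (-1 : ℝ) 1, |S.eval y| ≤ M) →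
      |(derivative S).eval (|x|)| ≤ (N + 1) * (2 * |x|) ^ N * M := by
    intro S hSd hSM
    refine abs_le'.mpr ⟨eval_derivative_le_of_abs_le hSd hM0 hSM hx, ?_⟩
    have := eval_derivative_le_of_abs_le (S := -S) (by simpa using hSd) hM0 (by simpa using hSM) hx
    simpa using this
  rcases abs_choice x with h | h
  · have := key S hSd hSM
    rwa [hSR, show R.eval (|x|) = R.eval x by rw [h]] at this
  · have := key (S.comp (-X)) (by simpa [natDegree_comp] using hSd) (by
      intro y hy
      simpa using hSM (-y) ⟨by linarith [hy.2], by linarith [hy.1]⟩)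
    rw [derivative_comp, hSR] at this
    simpa [show R.eval (-|x|) = R.eval x by rw [h, neg_neg]] using this

/-! ### Positivity of Gaussian integrals from local sign information. -/

theorem integrable_eval_mul_exp_neg_mul_sq (R : ℝ[X]) {b : ℝ} (hb : 0 < b) :
    MeasureTheory.Integrable fun x : ℝ => R.eval x * Real.exp (-b * x ^ 2) := by
  simp_rw [eval_eq_sum_range, Finset.sum_mul, mul_assoc]
  refine MeasureTheory.integrable_finsetSum _ fun k _ => MeasureTheory.Integrable.const_mul ?_ _
  simpa using integrable_rpow_mul_exp_neg_mul_sq hb (s := k) (by linarith [k.cast_nonneg (α := ℝ)])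

theorem exp_one_mul_pow_four_mul_exp_le {x : ℝ} (hx : 300 < |x|) :
    Real.exp 1 * (80 * x ^ 4 * Real.exp (-x ^ 2)) ≤ 4⁻¹ * (1 + x ^ 2)⁻¹ := by
  have hy : 90000 ≤ x ^ 2 := by
    rw [← sq_abs]; nlinarith
  have h1 := Real.pow_div_factorial_le_exp (x ^ 2) (by positivity) 4
  have h2 : Real.exp 1 ≤ 3 := by linarith [Real.exp_one_lt_d9]
  have e : x ^ 4 = (x ^ 2) ^ 2 := by ring
  rw [← mul_inv, Real.exp_neg, e]
  set y := x ^ 2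
  have hE := Real.exp_pos y
  norm_num [Nat.factorial] at h1
  rw [← mul_assoc, mul_inv_le_iff₀ hE, inv_mul_eq_div, le_div_iff₀ (by positivity)]
  have h3 : 1 + y ≤ 2 * y := by linarith
  calc Real.exp 1 * (80 * y ^ 2) * (4 * (1 + y)) ≤ 3 * (80 * y ^ 2) * (4 * (2 * y)) := by gcongr
    _ = 1920 * y ^ 3 := by ring
    _ ≤ y * y ^ 3 / 24 := by nlinarith [pow_nonneg (by linarith : (0 : ℝ) ≤ y) 3]
    _ = y ^ 4 / 24 := by ring
    _ ≤ _ := h1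

/-- Outside `[-300, 300]` a polynomial of degree at most `4n`, weighted by `exp (-n x²)`, is
controlled by its mass on `[-1, 1]`. -/
theorem abs_eval_mul_exp_le {n : ℕ} (hn : 1 ≤ n) {R : ℝ[X]} (hR : R.natDegree ≤ 4 * n) {x : ℝ}
    (hx : 300 < |x|) :
    |R.eval x| * Real.exp (-(n : ℝ) * x ^ 2) ≤
      Real.exp (-n) * (∫ t in (-1 : ℝ)..1, |R.eval t|) * (4⁻¹ * (1 + x ^ 2)⁻¹) := by
  set J := ∫ t in (-1 : ℝ)..1, |R.eval t| with hJ
  have hJ0 : 0 ≤ J := intervalIntegral.integral_nonneg (by norm_num) fun t _ => abs_nonneg _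
  have h1 := R.abs_eval_le_of_one_le_abs hR (x := x) (by linarith)
  -- Here `80 = 5 · 16`, from `4n + 1 ≤ 5ⁿ` and `(2|x|)⁴ = 16x⁴`.
  have h2 : ((4 * n : ℕ) + 1 : ℝ) * (2 * |x|) ^ (4 * n) ≤ (80 * x ^ 4) ^ n := by
    have h5 : ((4 * n : ℕ) + 1 : ℝ) ≤ 5 ^ n := by
      have := one_add_mul_le_pow (a := (4 : ℝ)) (by norm_num) n
      push_cast
      norm_num at this
      linarith
    have e : (2 * |x|) ^ 4 = 16 * x ^ 4 := by
      rw [mul_pow, Even.pow_abs (by decide)]; norm_num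
    rw [pow_mul, e, show 80 * x ^ 4 = 5 * (16 * x ^ 4) by ring, mul_pow 5]
    gcongr
  have h3 : (Real.exp 1 * (80 * x ^ 4 * Real.exp (-x ^ 2))) ^ n ≤ 4⁻¹ * (1 + x ^ 2)⁻¹ := by
    have hle : (4 : ℝ)⁻¹ * (1 + x ^ 2)⁻¹ ≤ 1 := by
      rw [← mul_inv]
      exact inv_le_one_of_one_le₀ (by nlinarith [sq_nonneg x])
    refine (pow_le_pow_left₀ (by positivity) (exp_one_mul_pow_four_mul_exp_le hx) n).trans ?_
    exact pow_le_of_le_one (by positivity) hle (by omega)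
  have e : Real.exp (-(n : ℝ)) * (Real.exp 1 * (80 * x ^ 4 * Real.exp (-x ^ 2))) ^ n =
      (80 * x ^ 4) ^ n * Real.exp (-(n : ℝ) * x ^ 2) := by
    rw [mul_pow, mul_pow, ← Real.exp_nat_mul, ← Real.exp_nat_mul, ← mul_assoc, ← Real.exp_add,
      mul_left_comm, ← mul_assoc]
    simp [mul_comm]
  calc |R.eval x| * Real.exp (-(n : ℝ) * x ^ 2)
      ≤ ((80 * x ^ 4) ^ n * J) * Real.exp (-(n : ℝ) * x ^ 2) := by
        gcongr
        exact h1.trans (by gcongr)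
    _ = Real.exp (-n) * J * (Real.exp 1 * (80 * x ^ 4 * Real.exp (-x ^ 2))) ^ n := by
        rw [mul_right_comm, ← e]; ring
    _ ≤ _ := by gcongr

/-- On `[-1, 1]` the Gaussian is at least `exp (-n)`, contributing `exp (-n) J`; the tails cost at
most `exp (-n) J · π/4`, and `π < 4`. -/
theorem integral_eval_mul_exp_pos {n : ℕ} (hn : 1 ≤ n) {R : ℝ[X]} (hR0 : R ≠ 0)
    (hR : R.natDegree ≤ 4 * n) (hpos : ∀ x : ℝ, |x| ≤ 300 → 0 ≤ R.eval x) :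
    0 < ∫ x : ℝ, R.eval x * Real.exp (-(n : ℝ) * x ^ 2) := by
  set J := ∫ t in (-1 : ℝ)..1, |R.eval t| with hJ
  have hJ0 : 0 ≤ J := intervalIntegral.integral_nonneg (by norm_num) fun t _ => abs_nonneg _
  have hJpos : 0 < J := by
    refine lt_of_le_of_ne hJ0 fun h0 => hR0 (eq_zero_of_infinite_isRoot R ?_)
    -- If `J = 0`, the growth bound makes `R` vanish on `[1, ∞)`.
    refine (Set.Ici_infinite (1 : ℝ)).mono fun x hx => ?_
    have h1 := R.abs_eval_le_of_one_le_abs hR (x := x) (hx.trans (le_abs_self x))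
    rw [← hJ, ← h0, mul_zero] at h1
    exact abs_nonpos_iff.mp h1
  have hn0 : (0 : ℝ) < n := by exact_mod_cast hn
  -- An integrable minorant of the integrand with explicit integral.
  set g : ℝ → ℝ := fun x => Real.exp (-n) * ((Set.Ioc (-1 : ℝ) 1).indicator (fun t => |R.eval t|) x)
    - Real.exp (-n) * J * (4⁻¹ * (1 + x ^ 2)⁻¹) with hg
  have hi1 : MeasureTheory.Integrable ((Set.Ioc (-1 : ℝ) 1).indicator (fun t => |R.eval t|)) := by
    rw [MeasureTheory.integrable_indicator_iff measurableSet_Ioc]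
    exact ((by fun_prop : Continuous fun t => |R.eval t|).intervalIntegrable (-1) 1).1
  have hi2 := integrable_inv_one_add_sq.const_mul (4⁻¹ : ℝ)
  have hgint : ∫ x, g x = Real.exp (-n) * J * (1 - Real.pi / 4) := by
    rw [hg, MeasureTheory.integral_sub (hi1.const_mul _) (hi2.const_mul _),
      MeasureTheory.integral_const_mul, MeasureTheory.integral_const_mul,
      MeasureTheory.integral_const_mul, integral_univ_inv_one_add_sq,
      MeasureTheory.integral_indicator measurableSet_Ioc, hJ,
      intervalIntegral.integral_of_le (by norm_num)]
    ring
  have hgle : ∀ x, g x ≤ R.eval x * Real.exp (-(n : ℝ) * x ^ 2) := by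
    intro x
    have hE := Real.exp_pos (-(n : ℝ) * x ^ 2)
    by_cases hx : 300 < |x|
    · have h1 := abs_eval_mul_exp_le hn hR hx
      have h2 : x ∉ Set.Ioc (-1 : ℝ) 1 := fun h => by
        have := abs_le.mpr ⟨h.1.le, h.2⟩
        linarith
      simp only [hg, Set.indicator_of_notMem h2]
      rw [← hJ] at h1
      nlinarith [neg_abs_le (R.eval x)]
    · push Not at hx
      have hq : 0 ≤ Real.exp (-n) * J * (4⁻¹ * (1 + x ^ 2)⁻¹) := by positivity
      have hRx := hpos x hx
      by_cases h2 : x ∈ Set.Ioc (-1 : ℝ) 1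
      · simp only [hg, Set.indicator_of_mem h2, abs_of_nonneg hRx]
        have : Real.exp (-n : ℝ) ≤ Real.exp (-(n : ℝ) * x ^ 2) := by
          have : x ^ 2 ≤ 1 := by nlinarith [h2.1, h2.2]
          exact Real.exp_le_exp.mpr (by nlinarith)
        nlinarith
      · simp only [hg, Set.indicator_of_notMem h2]
        have := mul_nonneg hRx hE.le
        linarith
  have hmono := MeasureTheory.integral_mono ((hi1.const_mul _).sub (hi2.const_mul _))
    (integrable_eval_mul_exp_neg_mul_sq R hn0) hgle
  refine lt_of_lt_of_le ?_ (hgint ▸ hmono)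
  have : 0 < 1 - Real.pi / 4 := by linarith [Real.pi_lt_four]
  positivity

theorem integral_eval_mul_exp_sub_pos {n : ℕ} (hn : 1 ≤ n) {R : ℝ[X]} (hR0 : R ≠ 0)
    (hR : R.natDegree ≤ 4 * n) (a : ℝ) (hpos : ∀ x : ℝ, |x - a| ≤ 300 → 0 ≤ R.eval x) :
    0 < ∫ x : ℝ, R.eval x * Real.exp (-(n : ℝ) * (x - a) ^ 2) := by
  have h := integral_eval_mul_exp_pos hn (R := R.comp (X + C a)) ?_ ?_ ?_
  · rw [← MeasureTheory.integral_sub_right_eq_self _ a] at h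
    simpa using h
  · intro h0
    have h1 := congrArg (fun p => p.comp (X - C a)) h0
    simp only [comp_assoc, add_comp, X_comp, C_comp, sub_add_cancel, comp_X, zero_comp] at h1
    exact hR0 h1
  · simpa [natDegree_comp] using hR
  · intro x hx
    simpa using hpos (x + a) (by simpa using hx)

/-! ### Sign changes of a polynomial on an interval. -/

theorem Polynomial.exists_eval_mul_nodal_const_sign {s : Set ℝ} (hs : s.OrdConnected) (P : ℝ[X])
    (hP : P ≠ 0) :
    ∃ Z : Finset ℝ, (∀ z ∈ Z, z ∈ s ∧ P.IsRoot z) ∧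
      ((∀ x ∈ s, 0 ≤ (P * Lagrange.nodal Z id).eval x) ∨
        ∀ x ∈ s, (P * Lagrange.nodal Z id).eval x ≤ 0) := by
  induction hd : P.natDegree using Nat.strong_induction_on generalizing P with
  | _ d ih =>
  by_cases h : ∃ z ∈ s, P.IsRoot z
  · obtain ⟨z, hzs, hz⟩ := h
    obtain ⟨Q, hQ⟩ := dvd_iff_isRoot.mpr hz
    have hQ0 : Q ≠ 0 := fun h => hP (by rw [hQ, h, mul_zero])
    have hdeg : Q.natDegree < d := by
      rw [← hd, hQ, natDegree_mul (X_sub_C_ne_zero z) hQ0, natDegree_X_sub_C]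
      omega
    obtain ⟨Z, hZ, hsign⟩ := ih _ hdeg Q hQ0 rfl
    have hZP : ∀ y ∈ Z, y ∈ s ∧ P.IsRoot y := fun y hy =>
      ⟨(hZ y hy).1, by rw [hQ]; exact root_mul_left_of_isRoot _ (hZ y hy).2⟩
    -- Each linear factor toggles membership of its root, so `Z` records the roots of odd
    -- multiplicity in `s`.
    by_cases hzZ : z ∈ Z
    · refine ⟨Z.erase z, fun y hy => hZP y (Finset.mem_of_mem_erase hy), ?_⟩
      have e : P * Lagrange.nodal (Z.erase z) id = Q * Lagrange.nodal Z id := by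
        rw [hQ, Lagrange.nodal_eq_mul_nodal_erase hzZ, id]; ring
      rwa [e]
    · refine ⟨insert z Z, fun y hy => ?_, ?_⟩
      · rcases Finset.mem_insert.mp hy with rfl | hy
        exacts [⟨hzs, hz⟩, hZP y hy]
      have e : ∀ x, (P * Lagrange.nodal (insert z Z) id).eval x =
          (x - z) ^ 2 * (Q * Lagrange.nodal Z id).eval x := by
        intro x
        rw [hQ, Lagrange.nodal_insert_eq_nodal hzZ]
        simp; ring
      simp_rw [e]
      exact hsign.imp (fun h x hx => mul_nonneg (sq_nonneg _) (h x hx))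
        (fun h x hx => mul_nonpos_of_nonneg_of_nonpos (sq_nonneg _) (h x hx))
  · push Not at h
    refine ⟨∅, by simp, ?_⟩
    simp only [Lagrange.nodal_empty, mul_one]
    by_contra! hcon
    obtain ⟨⟨x, hx, hx0⟩, ⟨y, hy, hy0⟩⟩ := hcon
    obtain ⟨z, hz, hz0⟩ := hs.isPreconnected.intermediate_value hx hy
      (f := fun t => P.eval t) (by fun_prop) ⟨hx0.le, hy0.le⟩
    exact h z hz hz0

/-! ### The three weights as shifted Gaussians, and orthogonality. -/

/-- The centre of the `j`-th multiple Hermite weight. -/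
noncomputable def hermiteCenter (c : ℝ) (j : Fin 3) : ℝ := ((j : ℕ) - 1 : ℝ) * (c / 2)

theorem hermiteWeight_eq (n : ℕ) (c : ℝ) (j : Fin 3) (x : ℝ) :
    hermiteWeight n c j x = Real.exp (n * hermiteCenter c j ^ 2) *
      Real.exp (-(n : ℝ) * (x - hermiteCenter c j) ^ 2) := by
  rw [← Real.exp_add]
  fin_cases j <;> simp [hermiteWeight, hermiteCenter] <;> ring

theorem integrable_eval_mul_hermiteWeight {n : ℕ} (hn : 1 ≤ n) (c : ℝ) (j : Fin 3) (R : ℝ[X]) :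
    MeasureTheory.Integrable fun x => R.eval x * hermiteWeight n c j x := by
  have hn0 : (0 : ℝ) < n := by exact_mod_cast hn
  have h := ((integrable_eval_mul_exp_neg_mul_sq (R.comp (X + C (hermiteCenter c j)))
    hn0).comp_sub_right (hermiteCenter c j)).const_mul (Real.exp (n * hermiteCenter c j ^ 2))
  refine h.congr (Filter.Eventually.of_forall fun x => ?_)
  simp only [hermiteWeight_eq, eval_comp, eval_add, eval_X, eval_C, sub_add_cancel]
  ring

theorem integrable_pow_mul_eval_mul_hermiteWeight {n : ℕ} (hn : 1 ≤ n) (c : ℝ) (j : Fin 3) (i : ℕ)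
    (R : ℝ[X]) : MeasureTheory.Integrable fun x => x ^ i * R.eval x * hermiteWeight n c j x :=
  (integrable_eval_mul_hermiteWeight hn c j (X ^ i * R)).congr
    (Filter.Eventually.of_forall fun x => by
      simp only [eval_mul, eval_pow, eval_X])

theorem integral_eval_mul_hermiteWeight_pos {n : ℕ} (hn : 1 ≤ n) (c : ℝ) (j : Fin 3) {R : ℝ[X]}
    (hR0 : R ≠ 0) (hR : R.natDegree ≤ 4 * n)
    (hpos : ∀ x : ℝ, |x - hermiteCenter c j| ≤ 300 → 0 ≤ R.eval x) :
    0 < ∫ x, R.eval x * hermiteWeight n c j x := by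
  simp_rw [hermiteWeight_eq, mul_left_comm (R.eval _)]
  rw [MeasureTheory.integral_const_mul]
  exact mul_pos (Real.exp_pos _) (integral_eval_mul_exp_sub_pos hn hR0 hR _ hpos)

theorem integral_eval_mul_hermiteWeight_eq_zero {n : ℕ} (hn : 1 ≤ n) {c : ℝ} {j : Fin 3}
    {P : ℝ[X]} (hP : ∀ i < n, ∫ x, x ^ i * P.eval x * hermiteWeight n c j x = 0) {q : ℝ[X]}
    (hq : q.natDegree < n) : ∫ x, (P * q).eval x * hermiteWeight n c j x = 0 := by
  have e : ∀ x, (P * q).eval x * hermiteWeight n c j x = ∑ i ∈ Finset.range n,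
      q.coeff i * (x ^ i * P.eval x * hermiteWeight n c j x) := by
    intro x
    rw [eval_mul, eval_eq_sum_range' hq, Finset.mul_sum, Finset.sum_mul]
    exact Finset.sum_congr rfl fun i _ => by ring
  simp_rw [e]
  rw [MeasureTheory.integral_finsetSum]
  · refine Finset.sum_eq_zero fun i hi => ?_
    rw [MeasureTheory.integral_const_mul, hP i (Finset.mem_range.mp hi), mul_zero]
  · intro i _
    refine MeasureTheory.Integrable.const_mul ?_ _
    exact integrable_pow_mul_eval_mul_hermiteWeight hn c j i P

/-! ### Location of the zeros. -/

/-- With fewer than `n` zeros there, a nodal factor of degree below `n` would make `P` one-signed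
near the centre; the product has degree at most `4n`, so its integral is nonzero, against
orthogonality. -/
theorem le_card_roots_near_hermiteCenter {n : ℕ} (hn : 1 ≤ n) {c : ℝ} {j : Fin 3} {P : ℝ[X]}
    (hP0 : P ≠ 0) (hPd : P.natDegree ≤ 3 * n)
    (hP : ∀ i < n, ∫ x, x ^ i * P.eval x * hermiteWeight n c j x = 0) :
    n ≤ (P.roots.toFinset.filter fun z => |z - hermiteCenter c j| ≤ 300).card := by
  by_contra! hlt
  have hs : Set.OrdConnected {x : ℝ | |x - hermiteCenter c j| ≤ 300} := by
    have : {x : ℝ | |x - hermiteCenter c j| ≤ 300} =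
        Set.Icc (hermiteCenter c j - 300) (hermiteCenter c j + 300) := by
      ext x
      simp only [Set.mem_ofPred_eq, abs_sub_le_iff, Set.mem_Icc]
      constructor <;> rintro ⟨h1, h2⟩ <;> constructor <;> linarith
    rw [this]; exact Set.ordConnected_Icc
  obtain ⟨Z, hZ, hsign⟩ := P.exists_eval_mul_nodal_const_sign hs hP0
  have hZc : Z.card < n := by
    refine lt_of_le_of_lt (Finset.card_le_card fun z hz => ?_) hlt
    simp only [Finset.mem_filter, Multiset.mem_toFinset, mem_roots hP0]
    exact ⟨(hZ z hz).2, (hZ z hz).1⟩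
  have hq : (Lagrange.nodal Z (id : ℝ → ℝ)).natDegree < n := by rwa [Lagrange.natDegree_nodal]
  have hint := integral_eval_mul_hermiteWeight_eq_zero hn hP hq
  set R := P * Lagrange.nodal Z (id : ℝ → ℝ) with hR
  have hR0 : R ≠ 0 := mul_ne_zero hP0 Lagrange.nodal_ne_zero
  have hRd : R.natDegree ≤ 4 * n := natDegree_mul_le.trans (by omega)
  rcases hsign with h | h
  · exact (integral_eval_mul_hermiteWeight_pos hn c j hR0 hRd h).ne' hint
  · have := integral_eval_mul_hermiteWeight_pos hn c j (R := -R) (neg_ne_zero.mpr hR0)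
      (by simpa using hRd) (fun x hx => by simpa using h x hx)
    simp [MeasureTheory.integral_neg, hint] at this

/-- Source of 1200: adjacent centres are `c/2` apart, which must exceed `300 + 300`. -/
theorem hermiteCenter_separated {c : ℝ} (hc : 1200 < c) {i j : Fin 3} (hij : i < j) {x y : ℝ}
    (hx : |x - hermiteCenter c i| ≤ 300) (hy : |y - hermiteCenter c j| ≤ 300) : x < y := by
  rw [abs_le] at hx hy
  have h1 : ((i : ℕ) : ℝ) + 1 ≤ (j : ℕ) := by exact_mod_cast hij
  have h2 : hermiteCenter c i + c / 2 ≤ hermiteCenter c j := by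
    unfold hermiteCenter; nlinarith
  linarith [hx.2, hy.1]

theorem three_mul_le_card_roots {n : ℕ} (hn : 1 ≤ n) {c : ℝ} (hc : 1200 < c) {P : ℝ[X]}
    (hP0 : P ≠ 0) (hPd : P.natDegree ≤ 3 * n)
    (hP : ∀ j, ∀ i < n, ∫ x, x ^ i * P.eval x * hermiteWeight n c j x = 0) :
    3 * n ≤ P.roots.toFinset.card := by
  have hdisj : (Set.univ : Set (Fin 3)).PairwiseDisjoint fun j =>
      P.roots.toFinset.filter fun z => |z - hermiteCenter c j| ≤ 300 := by
    intro i _ j _ hij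
    refine Finset.disjoint_filter.mpr fun z _ hi hj => ?_
    rcases lt_or_gt_of_ne hij with h | h
    · exact lt_irrefl _ (hermiteCenter_separated hc h hi hj)
    · exact lt_irrefl _ (hermiteCenter_separated hc h hj hi)
  calc 3 * n = ∑ _j : Fin 3, n := by simp
    _ ≤ ∑ j : Fin 3, (P.roots.toFinset.filter fun z => |z - hermiteCenter c j| ≤ 300).card :=
        Finset.sum_le_sum fun j _ => le_card_roots_near_hermiteCenter hn hP0 hPd (hP j)
    _ = (Finset.univ.biUnion fun j : Fin 3 =>
          P.roots.toFinset.filter fun z => |z - hermiteCenter c j| ≤ 300).card :=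
        (Finset.card_biUnion (by simpa using hdisj)).symm
    _ ≤ _ := Finset.card_le_card (Finset.biUnion_subset.mpr fun j _ => Finset.filter_subset _ _)

/-! ### Existence and uniqueness. -/

theorem eq_zero_of_orthogonal {n : ℕ} (hn : 1 ≤ n) {c : ℝ} (hc : 1200 < c) {P : ℝ[X]}
    (hPd : P.degree < (3 * n : ℕ))
    (hP : ∀ j, ∀ i < n, ∫ x, x ^ i * P.eval x * hermiteWeight n c j x = 0) : P = 0 := by
  by_contra hP0
  have hd : P.natDegree < 3 * n := (natDegree_lt_iff_degree_lt hP0).mpr hPd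
  have h1 := three_mul_le_card_roots hn hc hP0 hd.le hP
  have h2 := P.roots.toFinset_card_le
  have h3 := P.card_roots'
  omega

/-- The moments of a polynomial against the three weights. -/
noncomputable def hermiteMoments {n : ℕ} (hn : 1 ≤ n) (c : ℝ) :
    ℝ[X] →ₗ[ℝ] Fin 3 × Fin n → ℝ where
  toFun P := fun p => ∫ x, x ^ (p.2 : ℕ) * P.eval x * hermiteWeight n c p.1 x
  map_add' P Q := by
    ext p
    simp only [eval_add, mul_add, add_mul, Pi.add_apply]
    exact MeasureTheory.integral_add
      (integrable_pow_mul_eval_mul_hermiteWeight hn c p.1 (p.2 : ℕ) P)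
      (integrable_pow_mul_eval_mul_hermiteWeight hn c p.1 (p.2 : ℕ) Q)
  map_smul' r P := by
    ext p
    simp only [eval_smul, smul_eq_mul, Pi.smul_apply, RingHom.id_apply]
    rw [← MeasureTheory.integral_const_mul]
    congr 1; ext x; ring

theorem hermiteMoments_eq_zero_iff {n : ℕ} (hn : 1 ≤ n) (c : ℝ) (P : ℝ[X]) :
    hermiteMoments hn c P = 0 ↔
      ∀ j, ∀ i < n, ∫ x, x ^ i * P.eval x * hermiteWeight n c j x = 0 := by
  rw [funext_iff]
  exact ⟨fun h j i hi => h (j, ⟨i, hi⟩), fun h p => h p.1 p.2 p.2.2⟩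

/-- The moment map on polynomials of degree below `3n` is square and injective, hence bijective; the
lower-order part of `P` must cancel the moments of `X ^ (3n)`. -/
theorem existsUnique_multipleHermite {n : ℕ} (hn : 1 ≤ n) {c : ℝ} (hc : 1200 < c) :
    ∃! P : ℝ[X], IsTypeIIMultipleOrthogonal (hermiteWeight n c) (fun _ => n) P := by
  have hsum : ∑ _j : Fin 3, n = 3 * n := by simp
  have hinj : Function.Injective
      ((hermiteMoments hn c).comp (degreeLT ℝ (3 * n)).subtype) := by
    rw [← LinearMap.ker_eq_bot, LinearMap.ker_eq_bot']
    intro Q hQ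
    exact Subtype.ext (eq_zero_of_orthogonal hn hc (mem_degreeLT.mp Q.2)
      ((hermiteMoments_eq_zero_iff hn c _).mp hQ))
  have hsurj : Function.Surjective
      ((hermiteMoments hn c).comp (degreeLT ℝ (3 * n)).subtype) := by
    let e := (degreeLTEquiv ℝ (3 * n)).symm
    have : FiniteDimensional ℝ (degreeLT ℝ (3 * n)) := e.finiteDimensional
    refine (LinearMap.injective_iff_surjective_of_finrank_eq_finrank ?_).mp hinj
    rw [← e.finrank_eq]
    simp
  obtain ⟨Q, hQ⟩ := hsurj (-hermiteMoments hn c (X ^ (3 * n)))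
  have hQd : (Q : ℝ[X]).degree < (3 * n : ℕ) := mem_degreeLT.mp Q.2
  refine ⟨X ^ (3 * n) + (Q : ℝ[X]), ⟨monic_X_pow_add hQd, ?_, ?_⟩, ?_⟩
  · rw [hsum, natDegree_add_eq_left_of_degree_lt (by simpa using hQd), natDegree_X_pow]
  · rw [← hermiteMoments_eq_zero_iff hn c, map_add]
    simpa [add_comm, add_eq_zero_iff_eq_neg] using hQ
  · rintro P ⟨hPm, hPd, hP⟩
    have hd : (P - X ^ (3 * n)).degree < ((3 * n : ℕ) : WithBot ℕ) := by
      have h := degree_sub_lt_left (p := P) (q := X ^ (3 * n))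
        (by rw [degree_eq_natDegree hPm.ne_zero, hPd, hsum, degree_X_pow]) hPm.ne_zero
        (by rw [hPm.leadingCoeff, (monic_X_pow _).leadingCoeff])
      rwa [degree_eq_natDegree hPm.ne_zero, hPd, hsum] at h
    have h0 : hermiteMoments hn c (P - X ^ (3 * n) - (Q : ℝ[X])) = 0 := by
      have hP' := (hermiteMoments_eq_zero_iff hn c P).mpr hP
      have hQ' : hermiteMoments hn c Q = -hermiteMoments hn c (X ^ (3 * n)) := hQ
      rw [map_sub, map_sub, hP', hQ']
      simp
    have := eq_zero_of_orthogonal hn hc ((degree_sub_le _ _).trans_lt (max_lt hd hQd))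
      ((hermiteMoments_eq_zero_iff hn c _).mp h0)
    rw [sub_eq_zero, sub_eq_iff_eq_add'] at this
    exact this

/-! ### Nodes and exactness of the quadrature rule. -/

theorem exists_areIncreasingZeros {N : ℕ} {P : ℝ[X]} (h : N = P.roots.toFinset.card) :
    ∃ x : ℕ → ℝ, AreIncreasingZeros N P x := by
  let e := P.roots.toFinset.orderEmbOfFin h.symm
  refine ⟨fun k => if hk : k - 1 < N then e ⟨k - 1, hk⟩ else 0, ?_, ?_⟩
  · intro i hi j hj hij
    simp only [Set.mem_Icc] at hi hj
    simp only [show i - 1 < N by omega, show j - 1 < N by omega, dif_pos]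
    exact e.strictMono (Fin.mk_lt_mk.mpr (by omega))
  · intro k hk
    simp only [Set.mem_Icc] at hk
    simp only [show k - 1 < N by omega, dif_pos]
    have := P.roots.toFinset.orderEmbOfFin_mem h.symm ⟨k - 1, by omega⟩
    exact isRoot_of_mem_roots (Multiset.mem_toFinset.mp this)

theorem AreIncreasingZeros.image_eq {N : ℕ} {P : ℝ[X]} {x : ℕ → ℝ} (hx : AreIncreasingZeros N P x)
    (hP0 : P ≠ 0) (hPd : P.natDegree = N) : (Finset.Icc 1 N).image x = P.roots.toFinset := by
  refine Finset.eq_of_subset_of_card_le (fun z hz => ?_) ?_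
  · obtain ⟨k, hk, rfl⟩ := Finset.mem_image.mp hz
    simpa [hP0] using hx.2 k (by simpa using hk)
  · rw [Finset.card_image_of_injOn (by simpa using hx.1.injOn), Nat.card_Icc]
    have h2 := P.roots.toFinset_card_le
    have h3 := P.card_roots'
    omega

/-- Divide `f` by `P`: the quotient has degree below `n` and integrates to zero against `P`, and the
remainder is its own interpolant at the nodes. -/
theorem integral_eq_sum_quadratureWeight {n : ℕ} (hn : 1 ≤ n) {c : ℝ} {P : ℝ[X]}
    (hP : IsTypeIIMultipleOrthogonal (hermiteWeight n c) (fun _ => n) P) {x : ℕ → ℝ}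
    (hx : AreIncreasingZeros (3 * n) P x) (j : Fin 3) {f : ℝ[X]} (hf : f.natDegree ≤ 4 * n - 1) :
    ∫ t : ℝ, f.eval t * hermiteWeight n c j t =
      ∑ k ∈ Finset.Icc 1 (3 * n),
        quadratureWeight (hermiteWeight n c j) (3 * n) x k * f.eval (x k) := by
  obtain ⟨hPm, hPd, hPo⟩ := hP
  replace hPd : P.natDegree = 3 * n := by simpa using hPd
  have hinj : Set.InjOn x (Finset.Icc 1 (3 * n) : Finset ℕ) := by simpa using hx.1.injOn
  have hr : f %ₘ P = Lagrange.interpolate (Finset.Icc 1 (3 * n)) x fun k => f.eval (x k) := by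
    refine Lagrange.eq_interpolate_of_eval_eq _ hinj ?_ fun k hk => ?_
    · refine (degree_modByMonic_lt f hPm).trans_eq ?_
      rw [degree_eq_natDegree hPm.ne_zero, hPd]; simp
    · have h0 : P.eval (x k) = 0 := hx.2 k (by simpa using hk)
      conv_rhs => rw [← modByMonic_add_div f P]
      simp [h0]
  have hq : (f /ₘ P).natDegree < n := by
    rw [natDegree_divByMonic f hPm, hPd]; omega
  have h0 := integral_eval_mul_hermiteWeight_eq_zero hn (hPo j) hq
  have e : ∀ t, f.eval t * hermiteWeight n c j t =
      (∑ k ∈ Finset.Icc 1 (3 * n), f.eval (x k) *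
        ((Lagrange.basis (Finset.Icc 1 (3 * n)) x k).eval t * hermiteWeight n c j t)) +
      (P * (f /ₘ P)).eval t * hermiteWeight n c j t := by
    intro t
    conv_lhs => rw [← modByMonic_add_div f P]
    rw [eval_add, add_mul, hr, Lagrange.interpolate_apply, eval_finsetSum, Finset.sum_mul]
    simp [mul_assoc]
  have hi : ∀ k ∈ Finset.Icc 1 (3 * n), MeasureTheory.Integrable fun t => f.eval (x k) *
      ((Lagrange.basis (Finset.Icc 1 (3 * n)) x k).eval t * hermiteWeight n c j t) := fun k _ =>
    (integrable_eval_mul_hermiteWeight hn c j _).const_mul _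
  simp_rw [e]
  rw [MeasureTheory.integral_add (MeasureTheory.integrable_finsetSum _ hi)
    (integrable_eval_mul_hermiteWeight hn c j _), h0, add_zero, MeasureTheory.integral_finsetSum _ hi]
  refine Finset.sum_congr rfl fun k _ => ?_
  rw [MeasureTheory.integral_const_mul, quadratureWeight, mul_comm]

/-! ### Signs of the quadrature weights. -/

/-- The first two intervals hold at least `2n` zeros, all left of `t`. If `t ≤ x k`, they would all
be among the `k - 1 < 2n` nodes before `x k`. -/
theorem node_lt_of_le_two_mul {n : ℕ} (hn : 1 ≤ n) {c : ℝ} (hc : 1200 < c) {P : ℝ[X]}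
    (hP : IsTypeIIMultipleOrthogonal (hermiteWeight n c) (fun _ => n) P) {x : ℕ → ℝ}
    (hx : AreIncreasingZeros (3 * n) P x) {k : ℕ} (hk1 : 1 ≤ k) (hk : k ≤ 2 * n) {t : ℝ}
    (ht : |t - hermiteCenter c 2| ≤ 300) : x k < t := by
  obtain ⟨hPm, hPd, hPo⟩ := hP
  replace hPd : P.natDegree = 3 * n := by simpa using hPd
  by_contra! htk
  set Z : Fin 3 → Finset ℝ := fun j =>
    P.roots.toFinset.filter fun z => |z - hermiteCenter c j| ≤ 300 with hZ
  have hcard : ∀ j, n ≤ (Z j).card := fun j =>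
    le_card_roots_near_hermiteCenter hn hPm.ne_zero hPd.le (hPo j)
  have hdisj : Disjoint (Z 0) (Z 1) := Finset.disjoint_filter.mpr fun z _ h0 h1 =>
    lt_irrefl _ (hermiteCenter_separated hc (by decide) h0 h1)
  have hsub : Z 0 ∪ Z 1 ⊆ (Finset.Icc 1 (k - 1)).image x := by
    intro z hz
    have hzr : z ∈ P.roots.toFinset ∧ z < t := by
      rcases Finset.mem_union.mp hz with h | h <;> rw [Finset.mem_filter] at h
      · exact ⟨h.1, hermiteCenter_separated hc (by decide) h.2 ht⟩
      · exact ⟨h.1, hermiteCenter_separated hc (by decide) h.2 ht⟩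
    rw [← hx.image_eq hPm.ne_zero hPd, Finset.mem_image] at hzr
    obtain ⟨⟨i, hi, rfl⟩, hit⟩ := hzr
    rw [Finset.mem_Icc] at hi
    have : i < k := (hx.1.lt_iff_lt ⟨hi.1, hi.2⟩ ⟨hk1, by omega⟩).mp (hit.trans_le htk)
    exact Finset.mem_image_of_mem _ (Finset.mem_Icc.mpr ⟨hi.1, by omega⟩)
  have h1 := Finset.card_le_card hsub
  rw [Finset.card_union_of_disjoint hdisj] at h1
  have h2 := Finset.card_image_le (s := Finset.Icc 1 (k - 1)) (f := x)
  rw [Nat.card_Icc] at h2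
  have h3 := hcard 0
  have h4 := hcard 1
  omega

/-- If `A` and `B` cover all nodes except `x k`, where `A` consists of some of the first `2n`
nodes, then the quadrature weight at `x k` for `w₃` has the sign of the nodal polynomial of `A`
at `x k`. -/
theorem quadratureWeight_mul_eval_nodal_pos {n : ℕ} (hn : 1 ≤ n) {c : ℝ} (hc : 1200 < c) {P : ℝ[X]}
    (hP : IsTypeIIMultipleOrthogonal (hermiteWeight n c) (fun _ => n) P) {x : ℕ → ℝ}
    (hx : AreIncreasingZeros (3 * n) P x) {k : ℕ} (hk : k ∈ Finset.Icc 1 (3 * n)) {A B : Finset ℕ}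
    (hA : A ⊆ Finset.Icc 1 (2 * n))
    (hAB : A ∪ B = (Finset.Icc 1 (3 * n)).erase k) (hcard : A.card + 2 * B.card ≤ 4 * n - 1) :
    0 < quadratureWeight (hermiteWeight n c 2) (3 * n) x k * ∏ i ∈ A, (x k - x i) := by
  set f := Lagrange.nodal A x * Lagrange.nodal B x ^ 2 with hf
  have hfd : f.natDegree ≤ 4 * n - 1 := by
    refine (natDegree_mul_le.trans (add_le_add_right natDegree_pow_le _)).trans ?_
    simpa [Lagrange.natDegree_nodal] using hcard
  have hf0 : f ≠ 0 := mul_ne_zero Lagrange.nodal_ne_zero (pow_ne_zero _ Lagrange.nodal_ne_zero)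
  have hpos := integral_eval_mul_hermiteWeight_pos hn c 2 hf0 (hfd.trans (by omega)) (by
    intro t ht
    rw [hf, eval_mul, eval_pow, Lagrange.eval_nodal]
    refine mul_nonneg (Finset.prod_nonneg fun i hi => ?_) (sq_nonneg _)
    have hi' := Finset.mem_Icc.mp (hA hi)
    exact (sub_pos.mpr (node_lt_of_le_two_mul hn hc hP hx hi'.1 hi'.2 ht)).le)
  rw [integral_eq_sum_quadratureWeight hn hP hx 2 hfd, Finset.sum_eq_single k] at hpos
  · rw [hf, eval_mul, eval_pow, ← mul_assoc, Lagrange.eval_nodal] at hpos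
    exact pos_of_mul_pos_left hpos (sq_nonneg _)
  · intro i hi hik
    have : i ∈ A ∪ B := by rw [hAB]; exact Finset.mem_erase.mpr ⟨hik, hi⟩
    rw [hf, eval_mul, eval_pow]
    rcases Finset.mem_union.mp this with h | h <;> simp [Lagrange.eval_nodal_at_node h]
  · exact fun h => absurd hk h

theorem theorem5p6 :
    ∃ c₀ : ℝ, ∀ c : ℝ, c₀ < c → ∀ n : ℕ, 1 ≤ n →
      (∃! P : ℝ[X], IsTypeIIMultipleOrthogonal (hermiteWeight n c) (fun _ => n) P) ∧
      ∀ P : ℝ[X], IsTypeIIMultipleOrthogonal (hermiteWeight n c) (fun _ => n) P →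
        (∃ x : ℕ → ℝ, AreIncreasingZeros (3 * n) P x) ∧
        ∀ x : ℕ → ℝ, AreIncreasingZeros (3 * n) P x →
          (∀ f : ℝ[X], f.natDegree ≤ 4 * n - 1 →
            ∫ t : ℝ, f.eval t * hermiteWeight n c 2 t =
              ∑ k ∈ Finset.Icc 1 (3 * n),
                quadratureWeight (hermiteWeight n c 2) (3 * n) x k * f.eval (x k)) ∧
          (∀ k : ℕ, 2 * n + 1 ≤ k → k ≤ 3 * n →
            0 < quadratureWeight (hermiteWeight n c 2) (3 * n) x k) ∧
          (∀ k : ℕ, 1 ≤ k → k ≤ 2 * n →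
            Real.sign (quadratureWeight (hermiteWeight n c 2) (3 * n) x k) = (-1) ^ k) := by
  refine ⟨1200, fun c hc n hn => ⟨existsUnique_multipleHermite hn hc, fun P hP => ⟨?_, ?_⟩⟩⟩
  · obtain ⟨hPm, hPd, hPo⟩ := hP
    replace hPd : P.natDegree = 3 * n := by simpa using hPd
    refine exists_areIncreasingZeros ?_
    have h1 := three_mul_le_card_roots hn hc hPm.ne_zero hPd.le hPo
    have h2 := P.roots.toFinset_card_le
    have h3 := P.card_roots'
    omega
  intro x hx
  refine ⟨fun f hf => integral_eq_sum_quadratureWeight hn hP hx 2 hf, fun k hk1 hk2 => ?_,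
    fun k hk1 hk2 => ?_⟩
  · have h := quadratureWeight_mul_eval_nodal_pos hn hc hP hx (k := k)
      -- Degree `2n + 2(n - 1) = 4n - 2`; every factor of the `A`-product is positive at `x k`.
      (A := Finset.Icc 1 (2 * n)) (B := (Finset.Icc (2 * n + 1) (3 * n)).erase k)
      (Finset.mem_Icc.mpr ⟨by omega, hk2⟩) subset_rfl
      (by ext i; simp only [Finset.mem_union, Finset.mem_erase, Finset.mem_Icc]; omega)
      (by rw [Finset.card_erase_of_mem (Finset.mem_Icc.mpr ⟨hk1, hk2⟩), Nat.card_Icc, Nat.card_Icc]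
          omega)
    refine pos_of_mul_pos_left h (Finset.prod_nonneg fun i hi => ?_)
    rw [Finset.mem_Icc] at hi
    exact (sub_pos.mpr (hx.1 ⟨hi.1, by omega⟩ ⟨by omega, hk2⟩ (by omega))).le
  · have h := quadratureWeight_mul_eval_nodal_pos hn hc hP hx (k := k)
      -- Degree `(2n - 1) + 2n`, exactly the limit `4n - 1`; the `2n - k` nodes of `A` to the right
      -- of `x k` give the sign `(-1) ^ k`.
      (A := Finset.Icc 1 (k - 1) ∪ Finset.Icc (k + 1) (2 * n)) (B := Finset.Icc (2 * n + 1) (3 * n))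
      (Finset.mem_Icc.mpr ⟨hk1, by omega⟩)
      (fun i hi => by simp only [Finset.mem_union, Finset.mem_Icc] at hi ⊢; omega)
      (by ext i; simp only [Finset.mem_union, Finset.mem_erase, Finset.mem_Icc]; omega)
      (by have := Finset.card_union_le (Finset.Icc 1 (k - 1)) (Finset.Icc (k + 1) (2 * n))
          simp only [Nat.card_Icc] at this ⊢
          omega)
    have hdisj : Disjoint (Finset.Icc 1 (k - 1)) (Finset.Icc (k + 1) (2 * n)) :=
      Finset.disjoint_left.mpr fun i hi hj => by
        simp only [Finset.mem_Icc] at hi hj; omega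
    have hleft : 0 < ∏ i ∈ Finset.Icc 1 (k - 1), (x k - x i) := Finset.prod_pos fun i hi => by
      rw [Finset.mem_Icc] at hi
      exact sub_pos.mpr (hx.1 ⟨hi.1, by omega⟩ ⟨hk1, by omega⟩ (by omega))
    have hright : 0 < ∏ i ∈ Finset.Icc (k + 1) (2 * n), (x i - x k) := Finset.prod_pos fun i hi => by
      rw [Finset.mem_Icc] at hi
      exact sub_pos.mpr (hx.1 ⟨hk1, by omega⟩ ⟨by omega, by omega⟩ (by omega))
    have hneg : ∏ i ∈ Finset.Icc (k + 1) (2 * n), (x k - x i) =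
        (-1) ^ k * ∏ i ∈ Finset.Icc (k + 1) (2 * n), (x i - x k) := by
      have hk : (-1 : ℝ) ^ (2 * n - k) = (-1) ^ k := by
        rw [neg_one_pow_congr]; grind
      rw [← hk, ← show (Finset.Icc (k + 1) (2 * n)).card = 2 * n - k by rw [Nat.card_Icc]; omega,
        ← Finset.prod_const, ← Finset.prod_mul_distrib]
      exact Finset.prod_congr rfl fun i _ => by ring
    rw [Finset.prod_union hdisj, hneg, mul_left_comm] at h
    replace h := pos_of_mul_pos_right h hleft.le
    rw [← mul_assoc] at h
    replace h := pos_of_mul_pos_left h hright.le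
    rcases neg_one_pow_eq_or ℝ k with hk | hk <;> rw [hk] at h ⊢
    · exact Real.sign_of_pos (by linarith)
    · exact Real.sign_of_neg (by linarith)
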